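/- All graphs are finite, simple and undirected, and have at least one edge. For a graph $X$ with vertex set again denoted $X$, let $L_X = D_X - A_X$ be its Laplacian, $L_X^{\dagger}$ the Moore–Penrose pseudo-inverse of $L_X$, and $\mu^X$ the Gaussian probability measure on $\mathbb R^X$ with mean $0$ and covariance matrix $L_X^\dagger$. For graphs $X, Y$ with $N=|X|$ and $M=|Y|$ vertices, define $\Delta(X,Y)\in[0,\infty]$ by $$ NM\,\Delta(X,Y)^2 = \min_{P}\ \inf_{T}\ \int_{\mathbb R^X} \sum_{x\in X}\sum_{y\in Y} \bigl(f(x)-(Tf)(y)\bigr)^2 P(x,y)\, d\mu^X(f), $$ where $P$ ranges over the functions $P: X\times Y\to[0,\infty)$ such that $\sum_{x\in X}P(x,y)=N$ for all $y\in Y$ and $\sum_{y\in Y}P(x,y)=M$ for all $x\in X$, and $T$ ranges over the Borel maps $T:\mathbb R^X\to\mathbb R^Y$ (not necessarily linear) such that $T_{\#}\mu^X=\mu^Y$. **Lemma 3.2.** The minimum over $P$ is attained, and $\Delta$ is a metric on the set of isomorphism classes of finite graphs with at least one edge. That is, $\Delta(X,Y)$ is finite and depends only on the isomorphism classes of $X$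 and $Y$; $\Delta(X,Y)=0$ if and only if $X\cong Y$; $\Delta(X,Y)=\Delta(Y,X)$; and $\Delta(X,Z)\le\Delta(X,Y)+\Delta(Y,Z)$ for all such graphs $X,Y,Z$. -/

import Mathlib

open MeasureTheory ProbabilityTheory
open scoped ENNReal

universe u

noncomputable section

/-- The Moore-Penrose pseudo-inverse of a real symmetric matrix: the matrix with the same
eigenvectors in which every nonzero eigenvalue is inverted and the eigenvalue `0` is kept
(recall `0⁻¹ = 0`). The next lemmas check the Penrose equations. -/
def symmPinv {V : Type u} [Fintype V] [DecidableEq V] (A : Matrix V V ℝ) : Matrix V V ℝ :=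
  cfc (fun t : ℝ => t⁻¹) A

theorem symmPinv_isHermitian {V : Type u} [Fintype V] [DecidableEq V] (A : Matrix V V ℝ) :
    (symmPinv A).IsHermitian :=
  (cfc_predicate (fun t : ℝ => t⁻¹) A : IsSelfAdjoint _)

theorem symmPinv_penrose {V : Type u} [Fintype V] [DecidableEq V] {A : Matrix V V ℝ}
    (hA : A.IsHermitian) :
    A * symmPinv A * A = A ∧ symmPinv A * A * symmPinv A = symmPinv A ∧
      (A * symmPinv A).IsHermitian ∧ (symmPinv A * A).IsHermitian := by
  have hs : IsSelfAdjoint A := hA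
  have hc : ∀ f : ℝ → ℝ, ContinuousOn f (spectrum ℝ A) := fun f =>
    (Matrix.finite_real_spectrum (A := A)).continuousOn f
  have hid : cfc (fun t : ℝ => t) A = A := cfc_id' ℝ A
  have h1 : A * symmPinv A = cfc (fun t : ℝ => t * t⁻¹) A := by
    rw [cfc_mul _ _ A (hc _) (hc _), hid, symmPinv]
  have h2 : symmPinv A * A = cfc (fun t : ℝ => t⁻¹ * t) A := by
    rw [cfc_mul _ _ A (hc _) (hc _), hid, symmPinv]
  refine ⟨?_, ?_, ?_, ?_⟩
  · calc A * symmPinv A * A = cfc (fun t : ℝ => t * t⁻¹) A * cfc (fun t : ℝ => t) A := by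
          rw [h1, hid]
      _ = cfc (fun t : ℝ => t * t⁻¹ * t) A := (cfc_mul _ _ A (hc _) (hc _)).symm
      _ = cfc (fun t : ℝ => t) A := by simp only [mul_inv_mul_cancel]
      _ = A := hid
  · rw [h2, symmPinv, ← cfc_mul _ _ A (hc _) (hc _)]
    congr 1
    funext t
    by_cases ht : t = 0
    · simp [ht]
    · field_simp
  · rw [h1]
    exact (cfc_predicate (fun t : ℝ => t * t⁻¹) A : IsSelfAdjoint _)
  · rw [h2]
    exact (cfc_predicate (fun t : ℝ => t⁻¹ * t) A : IsSelfAdjoint _)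

theorem symmPinv_posSemidef {V : Type u} [Fintype V] [DecidableEq V] {A : Matrix V V ℝ}
    (hA : A.PosSemidef) : (symmPinv A).PosSemidef := by
  have h := hA.mul_mul_conjTranspose_same (symmPinv A)
  rwa [(symmPinv_isHermitian A).eq, (symmPinv_penrose hA.1).2.1] at h

/-- A finite (simple, undirected) graph. -/
structure FinGraph where
  V : Type u
  [fintypeV : Fintype V]
  graph : SimpleGraph V

attribute [instance] FinGraph.fintypeV

namespace FinGraph

open Classical in
/-- The pseudo-inverse `L_X†` of the Laplacian `L_X = D_X - A_X`. -/
def lapPinv (X : FinGraph.{u}) : Matrix X.V X.V ℝ :=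
  symmPinv (X.graph.lapMatrix ℝ)

theorem lapPinv_posSemidef (X : FinGraph.{u}) : X.lapPinv.PosSemidef := by
  classical
  exact symmPinv_posSemidef (SimpleGraph.posSemidef_lapMatrix ℝ X.graph)

open Classical in
/-- The graph signal `μ^X`: the centred Gaussian measure on `ℝ^X` with covariance `L_X†`. -/
def signal (X : FinGraph.{u}) : Measure (EuclideanSpace ℝ X.V) :=
  multivariateGaussian 0 X.lapPinv

/-- Scaled transport plans: nonnegative functions `P` on `X × Y` with `∑ x, P x y = |X|` for
every `y` and `∑ y, P x y = |Y|` for every `x`. -/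
structure IsPlan (X Y : FinGraph.{u}) (P : X.V → Y.V → ℝ) : Prop where
  nonneg : ∀ x y, 0 ≤ P x y
  sum_left : ∀ y, ∑ x, P x y = Fintype.card X.V
  sum_right : ∀ x, ∑ y, P x y = Fintype.card Y.V

/-- Transport maps: Borel maps `T : ℝ^X → ℝ^Y` that push `μ^X` forward to `μ^Y`. -/
structure IsTransportMap (X Y : FinGraph.{u})
    (T : EuclideanSpace ℝ X.V → EuclideanSpace ℝ Y.V) : Prop where
  measurable : Measurable T
  map_eq : X.signal.map T = Y.signal

/-- `∫ ∑ x, ∑ y, (f x - T f y)² P x y dμ^X(f)`, as an extended nonnegative number. -/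
def transportCost (X Y : FinGraph.{u}) (P : X.V → Y.V → ℝ)
    (T : EuclideanSpace ℝ X.V → EuclideanSpace ℝ Y.V) : ℝ≥0∞ :=
  ∫⁻ f, ENNReal.ofReal (∑ x, ∑ y, (f x - T f y) ^ 2 * P x y) ∂X.signal

/-- The infimum of the cost over all transport maps, for a fixed plan `P`
(`∞` if there is no transport map). -/
def planCost (X Y : FinGraph.{u}) (P : X.V → Y.V → ℝ) : ℝ≥0∞ :=
  ⨅ (T : EuclideanSpace ℝ X.V → EuclideanSpace ℝ Y.V) (_ : IsTransportMap X Y T),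
    transportCost X Y P T

/-- The coordinated optimal transport distance `Δ(X, Y)`, defined by
`|X| |Y| Δ(X, Y)² = min_P inf_T ∫ ∑ x, ∑ y, (f x - T f y)² P x y dμ^X(f)`. -/
def copt (X Y : FinGraph.{u}) : ℝ≥0∞ :=
  ((⨅ (P : X.V → Y.V → ℝ) (_ : IsPlan X Y P), planCost X Y P) /
    ((Fintype.card X.V : ℝ≥0∞) * (Fintype.card Y.V : ℝ≥0∞))) ^ (1 / 2 : ℝ)

end FinGraph

/-- Finite graphs with at least one edge. -/
abbrev FinGraphWithEdge : Type (u + 1) := {X : FinGraph.{u} // ∃ a b, X.graph.Adj a b}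

/-- Graph isomorphism as an equivalence relation. -/
instance isoSetoid : Setoid FinGraphWithEdge.{u} where
  r X Y := Nonempty (X.1.graph ≃g Y.1.graph)
  iseqv :=
    ⟨fun _ => ⟨SimpleGraph.Iso.refl⟩, fun ⟨e⟩ => ⟨e.symm⟩, fun ⟨e⟩ ⟨e'⟩ => ⟨e.trans e'⟩⟩

/-- Isomorphism classes of finite graphs with at least one edge. -/
abbrev GraphIsoClass : Type (u + 1) := Quotient isoSetoid.{u}

end

/-! Since the laws of `f` and `T f` are prescribed, expanding the square shows that the cost of a
transport map depends only on its cross-covariance `C x y = ∫ f x * T f y`. Any such `C` makes the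
block matrix with diagonal blocks `L_X†`, `L_Y†` and off-diagonal blocks `C`, `Cᵀ` positive
semidefinite. Conversely, every `C` with this property is the cross-covariance of a Gaussian
coupling. Because `X` has an edge, `μ^X` has no atoms, so the coupling can be approximated by Borel
maps (`exists_map_integral_mul_close`). The infimum over maps is thus a minimum over `C`, and
minimizing over `(P, C)` is a continuous problem on a compact set (`exists_isMinimal`).

Positive semidefinite matrices are Gram matrices. The problem becomes: place vectors `u x`, `v y`
with Gram matrices `L_X†`, `L_Y†` in a common Hilbert space so that the `P`-weighted sum of the `‖u
x - v y‖²` is least. This form is symmetric in `X` and `Y`. For the triangle inequality, two optimal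
placements are glued along the middle family by a linear isometry (`IsCrossCov.exists_glue`), the
plans are composed, and Minkowski's inequality applies.

If the distance is zero, an optimal plan charges only pairs with `u x = v y`. The kernel of `L†` is
that of `L`, the functions constant along edges; hence `u x = 0` exactly at isolated vertices, and
nonzero vectors are pairwise distinct (`eq_of_vector_eq`). A plan with this support forces a
bijection preserving vectors (`exists_equiv_of_plan`), which carries one `L†` to the other, hence
one Laplacian to the other. -/

noncomputable section

/-! ### Borel maps out of atomless laws -/

open Filter Topology Set in
/-- The distribution function of an atomless law on `ℝ` pushes it forward to the uniform law. -/
theorem measure_preimage_cdf_Iic (μ : Measure ℝ) [IsProbabilityMeasure μ] [NullSingletonClass μ]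
    {t : ℝ} (ht0 : 0 ≤ t) (ht1 : t < 1) : μ (cdf μ ⁻¹' Iic t) = ENNReal.ofReal t := by
  have hcont : Continuous (cdf μ) := by
    rw [continuous_iff_continuousAt]
    intro x
    rw [(monotone_cdf μ).continuousAt_iff_leftLim_eq_rightLim, StieltjesFunction.rightLim_eq]
    -- The jump of the distribution function at `x` is the mass of the atom there, which is zero.
    have h := (cdf μ).measure_singleton x
    rw [measure_cdf, measure_singleton] at h
    have h2 : cdf μ x - Function.leftLim (cdf μ) x ≤ 0 := ENNReal.ofReal_eq_zero.1 h.symm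
    exact le_antisymm ((monotone_cdf μ).leftLim_le le_rfl) (by linarith)
  have hex : ∀ s, 0 < s → s < 1 → ∃ a, cdf μ a = s := by
    intro s h0 h1
    obtain ⟨a, ha⟩ := ((tendsto_cdf_atBot μ).eventually (eventually_lt_nhds h0)).exists
    obtain ⟨b, hb⟩ := ((tendsto_cdf_atTop μ).eventually (eventually_gt_nhds h1)).exists
    exact mem_range_of_exists_le_of_exists_ge hcont ⟨a, ha.le⟩ ⟨b, hb.le⟩
  apply le_antisymm
  · apply ENNReal.le_of_forall_pos_le_add
    intro ε hε _
    -- The midpoint `(t + 1) / 2` keeps the level below `1`, where it is certain to be attained.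
    have hm : t < min (t + ε) ((t + 1) / 2) := lt_min (by simpa using hε) (by linarith)
    obtain ⟨a, ha⟩ := hex (min (t + ε) ((t + 1) / 2)) (by linarith)
      ((min_le_right _ _).trans_lt (by linarith))
    calc μ (cdf μ ⁻¹' Iic t) ≤ μ (Iic a) := by
          apply measure_mono
          intro x hx
          by_contra hxa
          have := monotone_cdf μ (not_le.1 hxa).le
          have hx' : cdf μ x ≤ t := hx
          linarith
      _ = ENNReal.ofReal (cdf μ a) := (ofReal_cdf μ a).symm
      _ ≤ ENNReal.ofReal (t + ε) := ENNReal.ofReal_le_ofReal (ha ▸ min_le_left _ _)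
      _ = ENNReal.ofReal t + ε := by
          rw [ENNReal.ofReal_add ht0 ε.coe_nonneg, ENNReal.ofReal_coe_nnreal]
  · rcases ht0.eq_or_lt with rfl | h0
    · simp
    · obtain ⟨a, ha⟩ := hex t h0 ht1
      rw [← ha, ofReal_cdf]
      exact measure_mono fun x hx => monotone_cdf μ hx

/-- Every probability law on a standard Borel space is a Borel image of a given atomless one. -/
theorem exists_measurable_map_eq_of_nullSingleton {E F : Type*} [MeasurableSpace E]
    [StandardBorelSpace E] [MeasurableSpace F] [StandardBorelSpace F] [Nonempty F]
    (μ : Measure E) [IsProbabilityMeasure μ] [NullSingletonClass μ]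
    (ν : Measure F) [IsProbabilityMeasure ν] :
    ∃ T : E → F, Measurable T ∧ μ.map T = ν := by
  have hemb := measurableEmbedding_embeddingReal E
  set e := embeddingReal E
  have : IsProbabilityMeasure (μ.map e) := Measure.isProbabilityMeasure_map hemb.measurable.aemeasurable
  have : NullSingletonClass (μ.map e) := ⟨fun x => by
    rw [hemb.map_apply]
    exact (Set.subsingleton_singleton.preimage hemb.injective).measure_zero μ⟩
  set c : E → unitInterval := fun x => ⟨cdf (μ.map e) (e x), cdf_nonneg _ _, cdf_le_one _ _⟩
  have hc : Measurable c :=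
    ((monotone_cdf (μ.map e)).measurable.comp hemb.measurable).subtype_mk
  have hcμ : μ.map c = volume := by
    have : IsProbabilityMeasure (μ.map c) := Measure.isProbabilityMeasure_map hc.aemeasurable
    apply Measure.ext_of_Iic
    intro t
    rcases t.2.2.eq_or_lt with h1 | h1
    · have : Set.Iic t = Set.univ := by
        ext x; simpa [Subtype.ext_iff, ← Subtype.coe_le_coe, h1] using x.2.2
      rw [this]; simp
    · rw [Measure.map_apply hc measurableSet_Iic, unitInterval.volume_Iic]
      rw [← measure_preimage_cdf_Iic (μ.map e) t.2.1 h1, hemb.map_apply]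
      rfl
  -- Every law is a Borel image of the uniform law, which `c` has just produced.
  obtain ⟨g, hg, hgν⟩ := ν.exists_measurable_map_eq
  exact ⟨g ∘ c, hg.comp hc, by rw [← Measure.map_map hg hc, hcμ, hgν]⟩

/-- Given a coupling `γ` of an atomless `μ` with another law, there is a Borel map `T` such that
`(d x, T x)` under `μ` is distributed as `(d x, y)` under `γ`, for a countable observable `d`. -/
theorem exists_map_prodMk_eq {E F ι : Type*} [MeasurableSpace E] [StandardBorelSpace E]
    [MeasurableSpace F] [StandardBorelSpace F] [Nonempty F] [Countable ι] [MeasurableSpace ι]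
    [MeasurableSingletonClass ι] (μ : Measure E) [IsFiniteMeasure μ] [NullSingletonClass μ]
    (γ : Measure (E × F)) (hγ : γ.map Prod.fst = μ) (d : E → ι) (hd : Measurable d) :
    ∃ T : E → F, Measurable T ∧
      μ.map (fun x => (d x, T x)) = γ.map (fun p => (d p.1, p.2)) := by
  have hcell : ∀ i, MeasurableSet (d ⁻¹' {i}) := fun i => hd (measurableSet_singleton i)
  have hγfin : IsFiniteMeasure γ := ⟨by
    have h : γ.map Prod.fst Set.univ < ⊤ := by rw [hγ]; exact measure_lt_top _ _
    rwa [Measure.map_apply measurable_fst MeasurableSet.univ, Set.preimage_univ] at h⟩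
  -- The map is built separately on each of the countably many cells of `d`, matching the
  -- conditional law of the second coordinate there.
  have key : ∀ i, ∃ T : E → F, Measurable T ∧
      (μ.restrict (d ⁻¹' {i})).map T = (γ.restrict (Prod.fst ⁻¹' (d ⁻¹' {i}))).map Prod.snd := by
    intro i
    set m := μ (d ⁻¹' {i}) with hm
    have hmγ : γ (Prod.fst ⁻¹' (d ⁻¹' {i})) = m := by
      rw [hm, ← hγ, Measure.map_apply measurable_fst (hcell i)]
    by_cases h0 : m = 0
    · refine ⟨fun _ => Classical.arbitrary F, measurable_const, ?_⟩
      rw [Measure.restrict_eq_zero.2 h0, Measure.restrict_eq_zero.2 (hmγ.trans h0)]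
      simp
    · have htop : m ≠ ⊤ := measure_ne_top _ _
      -- A restriction of an atomless law is atomless; the mass `m` is divided out to get
      -- probability laws and put back at the end.
      set μ' := m⁻¹ • μ.restrict (d ⁻¹' {i})
      set ν' := m⁻¹ • (γ.restrict (Prod.fst ⁻¹' (d ⁻¹' {i}))).map Prod.snd
      have h1 : IsProbabilityMeasure μ' := ⟨by
        simp only [μ', Measure.smul_apply, Measure.restrict_apply_univ, smul_eq_mul]
        exact ENNReal.inv_mul_cancel h0 htop⟩
      have h2 : IsProbabilityMeasure ν' := ⟨by
        simp only [ν', Measure.smul_apply, smul_eq_mul]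
        rw [Measure.map_apply measurable_snd MeasurableSet.univ, Set.preimage_univ,
          Measure.restrict_apply_univ, hmγ]
        exact ENNReal.inv_mul_cancel h0 htop⟩
      have h3 : NullSingletonClass μ' := ⟨fun x => by
        simp only [μ', Measure.smul_apply, smul_eq_mul]
        rw [measure_singleton, mul_zero]⟩
      obtain ⟨T, hT, hTμ⟩ := exists_measurable_map_eq_of_nullSingleton μ' ν'
      refine ⟨T, hT, ?_⟩
      have h4 := congrArg (fun ρ => m • ρ) hTμ
      simp only [μ', ν', Measure.map_smul] at h4
      rwa [smul_smul, smul_smul, ENNReal.mul_inv_cancel h0 htop, one_smul, one_smul] at h4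
  choose T hT hTmap using key
  have hTd : Measurable fun x => T (d x) x :=
    (measurable_from_prod_countable_right (f := fun p : ι × E => T p.1 p.2) hT).comp
      (hd.prodMk measurable_id)
  refine ⟨fun x => T (d x) x, hTd, ?_⟩
  have hdm : Measurable fun p : E × F => (d p.1, p.2) :=
    (hd.comp measurable_fst).prodMk measurable_snd
  ext s hs
  have hs' : ∀ i, MeasurableSet (Prod.mk i ⁻¹' s) := fun i => measurable_prodMk_left hs
  rw [Measure.map_apply (hd.prodMk hTd) hs, Measure.map_apply hdm hs]
  have e1 : (fun x => (d x, T (d x) x)) ⁻¹' s =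
      ⋃ i, (T i ⁻¹' (Prod.mk i ⁻¹' s)) ∩ d ⁻¹' {i} := by
    ext x; simp
  have e2 : (fun p : E × F => (d p.1, p.2)) ⁻¹' s =
      ⋃ i, (Prod.snd ⁻¹' (Prod.mk i ⁻¹' s)) ∩ Prod.fst ⁻¹' (d ⁻¹' {i}) := by
    ext x; simp
  rw [e1, e2, measure_iUnion, measure_iUnion]
  · congr 1
    funext i
    have h := congrArg (fun ρ => ρ (Prod.mk i ⁻¹' s)) (hTmap i)
    rwa [Measure.map_apply (hT i) (hs' i), Measure.map_apply measurable_snd (hs' i),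
      Measure.restrict_apply (hT i (hs' i)),
      Measure.restrict_apply (measurable_snd (hs' i))] at h
  · intro i j hij
    refine Set.disjoint_left.2 fun p hp hq => hij ?_
    rw [← hp.2, ← hq.2]
  · exact fun i => (measurable_snd (hs' i)).inter (measurable_fst (hcell i))
  · intro i j hij
    refine Set.disjoint_left.2 fun p hp hq => hij ?_
    rw [← hp.2, ← hq.2]
  · exact fun i => (hT i (hs' i)).inter (hcell i)

/-! ### Moments and marginals of Gaussian vectors -/

section GaussianMoments

variable {V W : Type*} [Fintype V] [Fintype W] [DecidableEq V] [DecidableEq W]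

theorem memLp_eval_multivariateGaussian (S : Matrix V V ℝ) (x : V) :
    MemLp (fun f : EuclideanSpace ℝ V => f x) 2 (multivariateGaussian 0 S) :=
  (EuclideanSpace.proj (𝕜 := ℝ) x).comp_memLp' IsGaussian.memLp_two_id

theorem integral_eval_multivariateGaussian (S : Matrix V V ℝ) (x : V) :
    ∫ f, f x ∂(multivariateGaussian (0 : EuclideanSpace ℝ V) S) = 0 := by
  have h := (EuclideanSpace.proj (𝕜 := ℝ) x).integral_comp_id_comm
    (μ := multivariateGaussian (0 : EuclideanSpace ℝ V) S) IsGaussian.integrable_id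
  simpa using h

theorem integral_eval_mul_eval_multivariateGaussian {S : Matrix V V ℝ} (hS : S.PosSemidef)
    (x y : V) :
    ∫ f, f x * f y ∂(multivariateGaussian (0 : EuclideanSpace ℝ V) S) = S x y := by
  rw [← covariance_eval_multivariateGaussian (μ := 0) hS x y,
    covariance_eq_sub (memLp_eval_multivariateGaussian S x) (memLp_eval_multivariateGaussian S y)]
  simp [integral_eval_multivariateGaussian]

/-- Coordinates of a Gaussian vector form a Gaussian vector. -/
theorem map_submatrix_multivariateGaussian {S : Matrix V V ℝ} (hS : S.PosSemidef) (e : W → V) :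
    (multivariateGaussian 0 S).map
        (fun f : EuclideanSpace ℝ V => (WithLp.toLp 2 fun w => f (e w) : EuclideanSpace ℝ W)) =
      multivariateGaussian 0 (S.submatrix e e) := by
  let L : EuclideanSpace ℝ V →L[ℝ] EuclideanSpace ℝ W :=
    LinearMap.toContinuousLinearMap
      { toFun := fun f => WithLp.toLp 2 fun w => f (e w)
        map_add' := fun f g => by ext; simp
        map_smul' := fun c f => by ext; simp }
  change (multivariateGaussian 0 S).map L = _
  apply IsGaussian.ext
  · simp only [id_eq, integral_id_multivariateGaussian]
    rw [ContinuousLinearMap.integral_id_map, integral_id_multivariateGaussian, map_zero]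
    exact IsGaussian.integrable_id
  rw [← ContinuousLinearMap.toBilinForm_inj]
  refine LinearMap.BilinForm.ext_basis (EuclideanSpace.basisFun W ℝ).toBasis fun i j => ?_
  rw [ContinuousLinearMap.toBilinForm_apply, ContinuousLinearMap.toBilinForm_apply,
    covarianceBilin_apply_eq_cov, covariance_map]
  · have h (i : W) : (fun u => inner ℝ ((EuclideanSpace.basisFun W ℝ).toBasis i) u) ∘ L =
        fun u => u (e i) := by
      ext; simp [PiLp.inner_apply, L]
    simp_rw [h, covariance_eval_multivariateGaussian hS,
      covarianceBilin_multivariateGaussian (hS.submatrix _)]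
    simp
  any_goals exact Measurable.aestronglyMeasurable (by fun_prop)
  · fun_prop
  · exact IsGaussian.memLp_two_id

/-- A point lies in a fibre of the coordinate `x`, whose law is a nondegenerate real Gaussian. -/
theorem nullSingletonClass_multivariateGaussian {S : Matrix V V ℝ} (hS : S.PosSemidef) {x : V}
    (hx : S x x ≠ 0) :
    NullSingletonClass (multivariateGaussian (0 : EuclideanSpace ℝ V) S) := by
  refine ⟨fun f => ?_⟩
  have hp := measurePreserving_eval_multivariateGaussian (μ := 0) hS (i := x)
  have hv : (S x x).toNNReal ≠ 0 := by
    have := hS.diag_nonneg (i := x)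
    simpa using lt_of_le_of_ne this hx.symm
  have := nullSingletonClass_gaussianReal (μ := (0 : EuclideanSpace ℝ V) x) hv
  refine measure_mono_null (t := (fun g : EuclideanSpace ℝ V => g x) ⁻¹' {f x}) (by simp) ?_
  rw [hp.measure_preimage (measurableSet_singleton _).nullMeasurableSet, measure_singleton]

end GaussianMoments

/-! ### Cross-covariances and their approximation by transport maps -/

/-- The cross-covariance matrices of couplings of centred laws with covariances `A` and `D`. -/
def IsCrossCov {V W : Type*} (A : Matrix V V ℝ) (D : Matrix W W ℝ) (C : Matrix V W ℝ) : Prop :=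
  (Matrix.fromBlocks A C C.transpose D).PosSemidef

theorem isCrossCov_of_inner {V W H : Type*} [Finite V] [Finite W] [NormedAddCommGroup H]
    [InnerProductSpace ℝ H] (u : V → H) (v : W → H)
    {A : Matrix V V ℝ} {D : Matrix W W ℝ} {C : Matrix V W ℝ}
    (hA : ∀ x x', inner ℝ (u x) (u x') = A x x') (hD : ∀ y y', inner ℝ (v y) (v y') = D y y')
    (hC : ∀ x y, inner ℝ (u x) (v y) = C x y) : IsCrossCov A D C := by
  have e : Matrix.fromBlocks A C C.transpose D = Matrix.gram ℝ (Sum.elim u v) := by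
    ext i j
    rcases i with i | i <;> rcases j with j | j
    · exact (hA i j).symm
    · exact (hC i j).symm
    · exact ((real_inner_comm _ _).trans (hC j i)).symm
    · exact (hD i j).symm
  have h := Matrix.posSemidef_gram ℝ (Sum.elim u v)
  rw [← e] at h
  exact h

/-- The inner products are those of `L²(μ)`. -/
theorem isCrossCov_integral {Ω V W : Type*} [Finite V] [Finite W] [MeasurableSpace Ω]
    (μ : Measure Ω) {f : V → Ω → ℝ} {g : W → Ω → ℝ} (hf : ∀ x, MemLp (f x) 2 μ)
    (hg : ∀ y, MemLp (g y) 2 μ) {A : Matrix V V ℝ} {D : Matrix W W ℝ} {C : Matrix V W ℝ}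
    (hA : ∀ x x', ∫ ω, f x ω * f x' ω ∂μ = A x x') (hD : ∀ y y', ∫ ω, g y ω * g y' ω ∂μ = D y y')
    (hC : ∀ x y, ∫ ω, f x ω * g y ω ∂μ = C x y) : IsCrossCov A D C := by
  have key : ∀ {a b : Ω → ℝ} (ha : MemLp a 2 μ) (hb : MemLp b 2 μ),
      inner ℝ (ha.toLp a) (hb.toLp b) = ∫ ω, a ω * b ω ∂μ := by
    intro a b ha hb
    rw [L2.inner_def]
    apply integral_congr_ae
    filter_upwards [ha.coeFn_toLp, hb.coeFn_toLp] with ω h1 h2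
    rw [h1, h2]
    simp [mul_comm]
  exact isCrossCov_of_inner (fun x => (hf x).toLp (f x)) (fun y => (hg y).toLp (g y))
    (fun x x' => (key _ _).trans (hA x x')) (fun y y' => (key _ _).trans (hD y y'))
    (fun x y => (key _ _).trans (hC x y))

/-- Replacing one factor by a uniformly close discretization changes a correlation little. -/
theorem abs_integral_mul_sub_le {Ω : Type*} [MeasurableSpace Ω] (ρ : Measure Ω)
    [IsProbabilityMeasure ρ] {q : ℝ → ℝ} (hqm : Measurable q) {δ : ℝ} (hδ0 : 0 < δ)
    (hq : ∀ t, |t - q t| ≤ δ) {a b : Ω → ℝ} (ha : MemLp a 2 ρ) (hb : MemLp b 2 ρ) :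
    |∫ ω, a ω * b ω ∂ρ - ∫ ω, q (a ω) * b ω ∂ρ| ≤ δ * (1 + ∫ ω, b ω * b ω ∂ρ) := by
  have hab : Integrable (fun ω => a ω * b ω) ρ := ha.integrable_mul hb
  have hbb : Integrable (fun ω => b ω * b ω) ρ := hb.integrable_mul hb
  have hmeas : AEStronglyMeasurable (fun ω => q (a ω)) ρ :=
    (hqm.comp_aemeasurable ha.1.aemeasurable).aestronglyMeasurable
  have hdiff : Integrable (fun ω => (a ω - q (a ω)) * b ω) ρ :=
    (hb.integrable (by norm_num)).bdd_mul (ha.1.sub hmeas)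
      (Filter.Eventually.of_forall fun ω => hq (a ω))
  have hqb : Integrable (fun ω => q (a ω) * b ω) ρ :=
    (hab.sub hdiff).congr (Filter.Eventually.of_forall fun ω => by simp; ring)
  rw [← integral_sub hab hqb]
  calc |∫ ω, (a ω * b ω - q (a ω) * b ω) ∂ρ|
      ≤ ∫ ω, |a ω * b ω - q (a ω) * b ω| ∂ρ := abs_integral_le_integral_abs
    _ ≤ ∫ ω, δ * (1 + b ω * b ω) ∂ρ := by
        apply integral_mono (hab.sub hqb).abs (((integrable_const 1).add hbb).const_mul δ)
        intro ω
        change |a ω * b ω - q (a ω) * b ω| ≤ δ * (1 + b ω * b ω)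
        rw [← sub_mul, abs_mul]
        apply mul_le_mul (hq _) _ (abs_nonneg _) hδ0.le
        rw [← abs_mul_abs_self (b ω)]
        -- This is the elementary bound `|b| ≤ 1 + b²`.
        nlinarith [sq_nonneg (|b ω| - 1 / 2)]
    _ = δ * (1 + ∫ ω, b ω * b ω ∂ρ) := by
        rw [integral_const_mul, integral_add (integrable_const _) hbb]
        simp

/-- Cut `ℝ^V` into cubes of side `δ` and choose `T` so that (cube of `f`, `T f`) is distributed as
(cube of the first marginal, second marginal) under the Gaussian coupling with cross-covariance `C`.
With each `f x` rounded to its cube the two correlations agree exactly, and each rounding costs at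
most `ε / 2`. -/
theorem exists_map_integral_mul_close {V W : Type*} [Fintype V] [Fintype W]
    [DecidableEq V] [DecidableEq W] {A : Matrix V V ℝ} {D : Matrix W W ℝ} {C : Matrix V W ℝ}
    (hA : A.PosSemidef) (hD : D.PosSemidef) (hC : IsCrossCov A D C) {x₀ : V} (hx₀ : A x₀ x₀ ≠ 0)
    {ε : ℝ} (hε : 0 < ε) :
    ∃ T : EuclideanSpace ℝ V → EuclideanSpace ℝ W, Measurable T ∧
      (multivariateGaussian 0 A).map T = multivariateGaussian 0 D ∧
      ∀ x y, |∫ f, f x * T f y ∂(multivariateGaussian 0 A) - C x y| ≤ ε := by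
  set μ := multivariateGaussian (0 : EuclideanSpace ℝ V) A with hμ
  set ν := multivariateGaussian (0 : EuclideanSpace ℝ W) D with hν
  set κ := multivariateGaussian (0 : EuclideanSpace ℝ (V ⊕ W))
    (Matrix.fromBlocks A C C.transpose D) with hκ
  have : NullSingletonClass μ := nullSingletonClass_multivariateGaussian hA hx₀
  let p₁ : EuclideanSpace ℝ (V ⊕ W) → EuclideanSpace ℝ V :=
    fun f => WithLp.toLp 2 fun x => f (Sum.inl x)
  let p₂ : EuclideanSpace ℝ (V ⊕ W) → EuclideanSpace ℝ W :=
    fun f => WithLp.toLp 2 fun x => f (Sum.inr x)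
  have hp₁ : Measurable p₁ := by fun_prop
  have hp₂ : Measurable p₂ := by fun_prop
  have hκ₁ : κ.map p₁ = μ := by
    rw [hκ, map_submatrix_multivariateGaussian hC Sum.inl]
    rfl
  have hκ₂ : κ.map p₂ = ν := by
    rw [hκ, map_submatrix_multivariateGaussian hC Sum.inr]
    rfl
  set m := ∑ y, D y y with hm
  have hDm : ∀ y, D y y ≤ m := fun y =>
    Finset.single_le_sum (f := fun y => D y y) (fun y _ => hD.diag_nonneg) (Finset.mem_univ y)
  have hm0 : 0 ≤ m := Finset.sum_nonneg fun y _ => hD.diag_nonneg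
  -- Chosen so that the rounding error `δ * (1 + D y y)` is at most `ε / 2` for every `y`.
  set δ := ε / (2 * (1 + m)) with hδ
  have hδ0 : 0 < δ := by positivity
  let q : ℝ → ℝ := fun t => δ * ⌊t / δ⌋
  have hq : ∀ t, |t - q t| ≤ δ := by
    intro t
    have h1 := Int.floor_le (t / δ)
    have h2 := (Int.lt_floor_add_one (t / δ)).le
    rw [le_div_iff₀ hδ0] at h1
    rw [div_le_iff₀ hδ0] at h2
    simp only [q]
    rw [abs_le]
    constructor <;> linarith
  have hqm : Measurable q := by fun_prop
  let d : EuclideanSpace ℝ V → (V → ℤ) := fun f x => ⌊f x / δ⌋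
  have hd : Measurable d := by fun_prop
  obtain ⟨T, hT, hTmap⟩ := exists_map_prodMk_eq μ (κ.map fun f => (p₁ f, p₂ f))
    (by rw [Measure.map_map measurable_fst (hp₁.prodMk hp₂)]; exact hκ₁) d hd
  rw [Measure.map_map (by fun_prop) (by fun_prop)] at hTmap
  have hTν : μ.map T = ν := by
    have h := congrArg (Measure.map Prod.snd) hTmap
    rw [Measure.map_map (by fun_prop) (by fun_prop),
      Measure.map_map (by fun_prop) (by fun_prop)] at h
    rw [← hκ₂]
    exact h
  refine ⟨T, hT, hTν, fun x y => ?_⟩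
  -- approximating the first factor by its cell value
  have hmix : ∀ x y, ∫ f, q (f x) * T f y ∂μ = ∫ f, q (f (Sum.inl x)) * f (Sum.inr y) ∂κ := by
    intro x y
    have hF : Measurable fun p : (V → ℤ) × EuclideanSpace ℝ W => δ * (p.1 x : ℝ) * p.2 y := by
      fun_prop
    have h1 := integral_map (μ := μ) (φ := fun f => (d f, T f)) (by fun_prop)
      hF.aestronglyMeasurable
    rw [hTmap, integral_map (by fun_prop) hF.aestronglyMeasurable] at h1
    exact h1.symm
  have hTy : MemLp (fun f => T f y) 2 μ := by
    have h := memLp_eval_multivariateGaussian D y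
    rw [← hν, ← hTν] at h
    exact (memLp_map_measure_iff h.1 hT.aemeasurable).1 h
  have hTy2 : ∫ f, T f y * T f y ∂μ = D y y := by
    rw [← integral_eval_mul_eval_multivariateGaussian hD y y, ← hν, ← hTν,
      integral_map hT.aemeasurable (Measurable.aestronglyMeasurable (by fun_prop))]
  have hδD : δ * (1 + D y y) ≤ ε / 2 := by
    calc δ * (1 + D y y) ≤ δ * (1 + m) := by gcongr; exact hDm y
      _ = ε / 2 := by rw [hδ]; field_simp
  have h1 := abs_integral_mul_sub_le μ hqm hδ0 hq (memLp_eval_multivariateGaussian A x) hTy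
  have h2 := abs_integral_mul_sub_le κ hqm hδ0 hq
    (memLp_eval_multivariateGaussian _ (Sum.inl x)) (memLp_eval_multivariateGaussian _ (Sum.inr y))
  rw [hmix, hTy2] at h1
  rw [integral_eval_mul_eval_multivariateGaussian hC, integral_eval_mul_eval_multivariateGaussian hC,
    Matrix.fromBlocks_apply₁₂, Matrix.fromBlocks_apply₂₂] at h2
  rw [abs_le] at h1 h2 ⊢
  constructor <;> linarith [h1.1, h1.2, h2.1, h2.2]

/-! ### Gram vectors and the transport energy -/

section CrossCovariance

variable {V W : Type*} [Fintype V] [Fintype W]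

-- The vectors are the columns of the square root of `S`.
open scoped MatrixOrder in
theorem Matrix.PosSemidef.exists_inner_eq {S : Matrix V V ℝ} (hS : S.PosSemidef) :
    ∃ u : V → EuclideanSpace ℝ V, ∀ i j, inner ℝ (u i) (u j) = S i j := by
  classical
  refine ⟨fun i => WithLp.toLp 2 fun k => CFC.sqrt S k i, fun i j => ?_⟩
  have h1 : (CFC.sqrt S).IsHermitian := (CFC.sqrt_nonneg S).isSelfAdjoint
  conv_rhs => rw [← CFC.sqrt_mul_sqrt_self S hS.nonneg, Matrix.mul_apply]
  simp only [PiLp.inner_apply]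
  refine Finset.sum_congr rfl fun k _ => ?_
  rw [← h1.apply i k]
  simp [mul_comm]

theorem IsCrossCov.exists_inner_eq {A : Matrix V V ℝ} {D : Matrix W W ℝ} {C : Matrix V W ℝ}
    (h : IsCrossCov A D C) :
    ∃ (u : V → EuclideanSpace ℝ (V ⊕ W)) (v : W → EuclideanSpace ℝ (V ⊕ W)),
      (∀ x x', inner ℝ (u x) (u x') = A x x') ∧ (∀ y y', inner ℝ (v y) (v y') = D y y') ∧
      ∀ x y, inner ℝ (u x) (v y) = C x y := by
  obtain ⟨w, hw⟩ := Matrix.PosSemidef.exists_inner_eq h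
  exact ⟨fun x => w (Sum.inl x), fun y => w (Sum.inr y), fun x x' => hw _ _, fun y y' => hw _ _,
    fun x y => hw _ _⟩

theorem IsCrossCov.symm {A : Matrix V V ℝ} {D : Matrix W W ℝ} {C : Matrix V W ℝ}
    (h : IsCrossCov A D C) : IsCrossCov D A C.transpose := by
  obtain ⟨u, v, hu, hv, huv⟩ := h.exists_inner_eq
  exact isCrossCov_of_inner v u hv hu fun y x => (real_inner_comm _ _).trans (huv x y)

/-- Placing the two families in orthogonal summands corresponds to the independent coupling. -/
theorem isCrossCov_zero {A : Matrix V V ℝ} {D : Matrix W W ℝ} (hA : A.PosSemidef)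
    (hD : D.PosSemidef) : IsCrossCov A D 0 := by
  obtain ⟨u, hu⟩ := hA.exists_inner_eq
  obtain ⟨v, hv⟩ := hD.exists_inner_eq
  refine isCrossCov_of_inner
    (H := WithLp 2 (EuclideanSpace ℝ V × EuclideanSpace ℝ W))
    (fun x => WithLp.toLp 2 (u x, 0)) (fun y => WithLp.toLp 2 (0, v y)) ?_ ?_ ?_
  · intro x x'; simp [WithLp.prod_inner_apply, hu]
  · intro y y'; simp [WithLp.prod_inner_apply, hv]
  · intro x y; simp [WithLp.prod_inner_apply]

/-- This bound makes the set of cross-covariances compact. -/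
theorem IsCrossCov.two_mul_abs_le {A : Matrix V V ℝ} {D : Matrix W W ℝ} {C : Matrix V W ℝ}
    (h : IsCrossCov A D C) (x : V) (y : W) : 2 * |C x y| ≤ A x x + D y y := by
  obtain ⟨u, v, hu, hv, huv⟩ := h.exists_inner_eq
  rw [← huv, ← hu, ← hv, real_inner_self_eq_norm_sq, real_inner_self_eq_norm_sq]
  nlinarith [abs_real_inner_le_norm (u x) (v y), sq_nonneg (‖u x‖ - ‖v y‖)]

theorem isClosed_setOf_isCrossCov (A : Matrix V V ℝ) (D : Matrix W W ℝ) :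
    IsClosed {C : V → W → ℝ | IsCrossCov A D (Matrix.of C)} := by
  simp only [IsCrossCov, Matrix.posSemidef_iff_dotProduct_mulVec, Set.ofPred_and, Set.ofPred_forall]
  have hc : Continuous fun C : V → W → ℝ =>
      Matrix.fromBlocks A (Matrix.of C) (Matrix.of C).transpose D := by
    have h : Continuous fun C : V → W → ℝ => (Matrix.of C : Matrix V W ℝ) := continuous_id
    exact continuous_const.matrix_fromBlocks h h.matrix_transpose continuous_const
  refine IsClosed.inter (isClosed_eq hc.matrix_conjTranspose hc) (isClosed_iInter fun a => ?_)
  exact isClosed_le continuous_const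
    (continuous_const.dotProduct (hc.matrix_mulVec continuous_const))

/-- The transport energy of a plan `P` and a cross-covariance `C`: the sum of the expected squared
differences of the coordinates, weighted by `P`. -/
def couplingEnergy (A : Matrix V V ℝ) (D : Matrix W W ℝ) (P C : V → W → ℝ) : ℝ :=
  ∑ x, ∑ y, (A x x + D y y - 2 * C x y) * P x y

theorem couplingEnergy_eq_of_inner {H : Type*} [NormedAddCommGroup H] [InnerProductSpace ℝ H]
    {u : V → H} {v : W → H} {A : Matrix V V ℝ} {D : Matrix W W ℝ} {C : V → W → ℝ}
    (hA : ∀ x x', inner ℝ (u x) (u x') = A x x') (hD : ∀ y y', inner ℝ (v y) (v y') = D y y')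
    (hC : ∀ x y, inner ℝ (u x) (v y) = C x y) (P : V → W → ℝ) :
    couplingEnergy A D P C = ∑ x, ∑ y, ‖u x - v y‖ ^ 2 * P x y := by
  unfold couplingEnergy
  refine Finset.sum_congr rfl fun x _ => Finset.sum_congr rfl fun y _ => ?_
  rw [norm_sub_sq_real, ← hA, ← hD, ← hC, real_inner_self_eq_norm_sq, real_inner_self_eq_norm_sq]
  ring

theorem continuous_couplingEnergy (A : Matrix V V ℝ) (D : Matrix W W ℝ) :
    Continuous fun p : (V → W → ℝ) × (V → W → ℝ) => couplingEnergy A D p.1 p.2 := by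
  unfold couplingEnergy
  fun_prop

theorem couplingEnergy_transpose (A : Matrix V V ℝ) (D : Matrix W W ℝ) (P C : V → W → ℝ) :
    couplingEnergy D A (fun y x => P x y) (fun y x => C x y) = couplingEnergy A D P C := by
  unfold couplingEnergy
  rw [Finset.sum_comm]
  refine Finset.sum_congr rfl fun x _ => Finset.sum_congr rfl fun y _ => ?_
  ring

theorem couplingEnergy_le_add {A : Matrix V V ℝ} {D : Matrix W W ℝ} {P C C' : V → W → ℝ} {ε : ℝ}
    (hP : ∀ x y, 0 ≤ P x y) (h : ∀ x y, |C' x y - C x y| ≤ ε) :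
    couplingEnergy A D P C' ≤ couplingEnergy A D P C + 2 * ε * ∑ x, ∑ y, P x y := by
  unfold couplingEnergy
  simp only [Finset.mul_sum, ← Finset.sum_add_distrib]
  refine Finset.sum_le_sum fun x _ => Finset.sum_le_sum fun y _ => ?_
  have := (abs_le.1 (h x y)).1
  nlinarith [hP x y]

end CrossCovariance

/-! ### Existence of minimizers and reduction of maps to cross-covariances -/

namespace FinGraph

variable {X Y : FinGraph.{u}}

theorem IsPlan.symm {P : X.V → Y.V → ℝ} (h : IsPlan X Y P) : IsPlan Y X fun y x => P x y :=
  ⟨fun y x => h.nonneg x y, h.sum_right, h.sum_left⟩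

theorem isPlan_one (X Y : FinGraph.{u}) : IsPlan X Y fun _ _ => 1 :=
  ⟨fun _ _ => zero_le_one, fun _ => by simp, fun _ => by simp⟩

theorem IsPlan.le_card {P : X.V → Y.V → ℝ} (h : IsPlan X Y P) (x : X.V) (y : Y.V) :
    P x y ≤ Fintype.card Y.V := by
  rw [← h.sum_right x]
  exact Finset.single_le_sum (f := fun y => P x y) (fun y _ => h.nonneg x y) (Finset.mem_univ y)

theorem isClosed_setOf_isPlan (X Y : FinGraph.{u}) : IsClosed {P | IsPlan X Y P} := by
  have e : {P | IsPlan X Y P} = {P | ∀ x y, 0 ≤ P x y} ∩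
      ({P | ∀ y, ∑ x, P x y = (Fintype.card X.V : ℝ)} ∩
        {P | ∀ x, ∑ y, P x y = (Fintype.card Y.V : ℝ)}) := by
    ext P
    exact ⟨fun h => ⟨h.nonneg, h.sum_left, h.sum_right⟩, fun h => ⟨h.1, h.2.1, h.2.2⟩⟩
  rw [e]
  simp only [Set.ofPred_forall]
  refine IsClosed.inter (isClosed_iInter fun x => isClosed_iInter fun y =>
    isClosed_le (by fun_prop) (by fun_prop)) (IsClosed.inter ?_ ?_)
  · exact isClosed_iInter fun y => isClosed_eq (by fun_prop) (by fun_prop)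
  · exact isClosed_iInter fun x => isClosed_eq (by fun_prop) (by fun_prop)

/-- A plan and a cross-covariance that minimize the transport energy. -/
structure IsMinimal (X Y : FinGraph.{u}) (P C : X.V → Y.V → ℝ) : Prop where
  isPlan : IsPlan X Y P
  isCrossCov : IsCrossCov X.lapPinv Y.lapPinv (Matrix.of C)
  le : ∀ Q C', IsPlan X Y Q → IsCrossCov X.lapPinv Y.lapPinv (Matrix.of C') →
    couplingEnergy X.lapPinv Y.lapPinv P C ≤ couplingEnergy X.lapPinv Y.lapPinv Q C'

theorem exists_isMinimal (X Y : FinGraph.{u}) : ∃ P C, IsMinimal X Y P C := by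
  let K : Set ((X.V → Y.V → ℝ) × (X.V → Y.V → ℝ)) :=
    {P | IsPlan X Y P} ×ˢ {C | IsCrossCov X.lapPinv Y.lapPinv (Matrix.of C)}
  have hK : IsCompact K := by
    apply IsCompact.prod
    · have hb : IsCompact (Set.pi Set.univ fun _ : X.V => Set.pi Set.univ fun _ : Y.V =>
          Set.Icc (0 : ℝ) (Fintype.card Y.V)) :=
        isCompact_univ_pi fun _ => isCompact_univ_pi fun _ => isCompact_Icc
      exact hb.of_isClosed_subset (isClosed_setOf_isPlan X Y) fun P hP x _ y _ =>
        ⟨hP.nonneg x y, hP.le_card x y⟩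
    · have hb : IsCompact (Set.pi Set.univ fun x : X.V => Set.pi Set.univ fun y : Y.V =>
          Set.Icc (-((X.lapPinv x x + Y.lapPinv y y) / 2))
            ((X.lapPinv x x + Y.lapPinv y y) / 2)) :=
        isCompact_univ_pi fun _ => isCompact_univ_pi fun _ => isCompact_Icc
      exact hb.of_isClosed_subset (isClosed_setOf_isCrossCov _ _) fun C hC x _ y _ =>
        abs_le.1 (by
          have := IsCrossCov.two_mul_abs_le hC x y
          simp only [Matrix.of_apply] at this
          linarith)
  have hne : K.Nonempty := ⟨(fun _ _ => 1, fun _ _ => 0), isPlan_one X Y,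
    isCrossCov_zero X.lapPinv_posSemidef Y.lapPinv_posSemidef⟩
  obtain ⟨⟨P, C⟩, ⟨hP, hC⟩, hmin⟩ :=
    hK.exists_isMinOn hne (continuous_couplingEnergy X.lapPinv Y.lapPinv).continuousOn
  exact ⟨P, C, hP, hC, fun Q C' hQ hC' => hmin (a := (Q, C')) ⟨hQ, hC'⟩⟩

instance (X : FinGraph.{u}) : IsProbabilityMeasure X.signal := by
  unfold signal; infer_instance

theorem memLp_eval_signal (X : FinGraph.{u}) (x : X.V) :
    MemLp (fun f : EuclideanSpace ℝ X.V => f x) 2 X.signal := by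
  classical exact memLp_eval_multivariateGaussian _ x

theorem integral_eval_mul_eval_signal (X : FinGraph.{u}) (x x' : X.V) :
    ∫ f, f x * f x' ∂X.signal = X.lapPinv x x' := by
  classical exact integral_eval_mul_eval_multivariateGaussian X.lapPinv_posSemidef x x'

theorem IsTransportMap.memLp {T : EuclideanSpace ℝ X.V → EuclideanSpace ℝ Y.V}
    (hT : IsTransportMap X Y T) (y : Y.V) : MemLp (fun f => T f y) 2 X.signal := by
  have h := Y.memLp_eval_signal y
  rw [← hT.map_eq] at h
  exact (memLp_map_measure_iff h.1 hT.measurable.aemeasurable).1 h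

theorem IsTransportMap.integral_mul {T : EuclideanSpace ℝ X.V → EuclideanSpace ℝ Y.V}
    (hT : IsTransportMap X Y T) (y y' : Y.V) :
    ∫ f, T f y * T f y' ∂X.signal = Y.lapPinv y y' := by
  rw [← integral_eval_mul_eval_signal, ← hT.map_eq, integral_map hT.measurable.aemeasurable
    (Measurable.aestronglyMeasurable (by fun_prop))]

theorem IsTransportMap.isCrossCov {T : EuclideanSpace ℝ X.V → EuclideanSpace ℝ Y.V}
    (hT : IsTransportMap X Y T) :
    IsCrossCov X.lapPinv Y.lapPinv (Matrix.of fun x y => ∫ f, f x * T f y ∂X.signal) :=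
  isCrossCov_integral X.signal (f := fun x f => f x) (g := fun y f => T f y)
    (X.memLp_eval_signal) hT.memLp (X.integral_eval_mul_eval_signal) hT.integral_mul
    fun _ _ => rfl

theorem IsTransportMap.transportCost_eq {T : EuclideanSpace ℝ X.V → EuclideanSpace ℝ Y.V}
    (hT : IsTransportMap X Y T) {P : X.V → Y.V → ℝ} (hP : ∀ x y, 0 ≤ P x y) :
    transportCost X Y P T = ENNReal.ofReal (couplingEnergy X.lapPinv Y.lapPinv P
      fun x y => ∫ f, f x * T f y ∂X.signal) := by
  have hint : ∀ x y, Integrable (fun f => (f x - T f y) ^ 2 * P x y) X.signal := fun x y =>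
    ((X.memLp_eval_signal x).sub (hT.memLp y)).integrable_sq.mul_const _
  unfold transportCost
  rw [← ofReal_integral_eq_lintegral_ofReal
    (integrable_finsetSum _ fun x _ => integrable_finsetSum _ fun y _ => hint x y)
    (Filter.Eventually.of_forall fun f => Finset.sum_nonneg fun x _ => Finset.sum_nonneg fun y _ =>
      mul_nonneg (sq_nonneg _) (hP x y))]
  congr 1
  rw [integral_finsetSum _ fun x _ => integrable_finsetSum _ fun y _ => hint x y]
  unfold couplingEnergy
  refine Finset.sum_congr rfl fun x _ => ?_
  rw [integral_finsetSum _ fun y _ => hint x y]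
  refine Finset.sum_congr rfl fun y _ => ?_
  rw [integral_mul_const]
  congr 1
  have h1 : Integrable (fun f => f x * f x) X.signal :=
    (X.memLp_eval_signal x).integrable_mul (X.memLp_eval_signal x)
  have h2 : Integrable (fun f => T f y * T f y) X.signal := (hT.memLp y).integrable_mul (hT.memLp y)
  have h3 : Integrable (fun f => f x * T f y) X.signal :=
    (X.memLp_eval_signal x).integrable_mul (hT.memLp y)
  have h12 : Integrable (fun f => f x * f x + T f y * T f y) X.signal := h1.add h2
  have e : ∀ f : EuclideanSpace ℝ X.V,
      (f x - T f y) ^ 2 = f x * f x + T f y * T f y - 2 * (f x * T f y) := fun f => by ring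
  simp only [e]
  rw [integral_sub h12 (h3.const_mul 2), integral_add h1 h2, integral_const_mul,
    integral_eval_mul_eval_signal, hT.integral_mul]

/-- The cross-covariance of any transport map competes in the minimization. -/
theorem le_planCost {P C Q : X.V → Y.V → ℝ} (h : IsMinimal X Y P C) (hQ : IsPlan X Y Q) :
    ENNReal.ofReal (couplingEnergy X.lapPinv Y.lapPinv P C) ≤ planCost X Y Q := by
  refine le_iInf₂ fun T hT => ?_
  rw [hT.transportCost_eq hQ.nonneg]
  exact ENNReal.ofReal_le_ofReal (h.le _ _ hQ hT.isCrossCov)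

/-- The nonzero variance makes the source atomless, so maps with cross-covariance arbitrarily close
to `C` exist, and the energy is linear in `C`. -/
theorem planCost_le {x₀ : X.V} (hx₀ : X.lapPinv x₀ x₀ ≠ 0) {P C : X.V → Y.V → ℝ}
    (hP : IsPlan X Y P) (hC : IsCrossCov X.lapPinv Y.lapPinv (Matrix.of C)) :
    planCost X Y P ≤ ENNReal.ofReal (couplingEnergy X.lapPinv Y.lapPinv P C) := by
  classical
  apply ENNReal.le_of_forall_pos_le_add
  intro ε hε _
  set s := ∑ x, ∑ y, P x y with hs
  have hs0 : 0 ≤ s := Finset.sum_nonneg fun x _ => Finset.sum_nonneg fun y _ => hP.nonneg x y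
  -- An entrywise error `η` in `C` changes the energy by at most `2 * η * s`; `s + 1` avoids
  -- dividing by zero.
  have hη : (0 : ℝ) < ε / (2 * (s + 1)) := by positivity
  obtain ⟨T, hT, hmap, hclose⟩ := exists_map_integral_mul_close X.lapPinv_posSemidef
    Y.lapPinv_posSemidef hC hx₀ hη
  have hTm : IsTransportMap X Y T := ⟨hT, by unfold signal; convert hmap⟩
  refine (iInf₂_le T hTm).trans ?_
  rw [hTm.transportCost_eq hP.nonneg, ← ENNReal.ofReal_coe_nnreal]
  refine (ENNReal.ofReal_le_ofReal ?_).trans ENNReal.ofReal_add_le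
  refine (couplingEnergy_le_add (C := C) hP.nonneg (ε := ε / (2 * (s + 1))) fun x y => ?_).trans ?_
  · have h := hclose x y
    rw [Matrix.of_apply] at h
    unfold signal
    convert h
  · rw [← hs]
    gcongr
    have : 2 * ((ε : ℝ) / (2 * (s + 1))) * s = ε * (s / (s + 1)) := by field_simp
    rw [this]
    exact mul_le_of_le_one_right ε.coe_nonneg ((div_le_one (by positivity)).2 (by linarith))

theorem IsMinimal.planCost_eq {x₀ : X.V} (hx₀ : X.lapPinv x₀ x₀ ≠ 0) {P C : X.V → Y.V → ℝ}
    (h : IsMinimal X Y P C) :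
    planCost X Y P = ENNReal.ofReal (couplingEnergy X.lapPinv Y.lapPinv P C) :=
  le_antisymm (planCost_le hx₀ h.isPlan h.isCrossCov) (le_planCost h h.isPlan)

theorem IsMinimal.iInf_planCost_eq {x₀ : X.V} (hx₀ : X.lapPinv x₀ x₀ ≠ 0) {P C : X.V → Y.V → ℝ}
    (h : IsMinimal X Y P C) :
    ⨅ (Q : X.V → Y.V → ℝ) (_ : IsPlan X Y Q), planCost X Y Q =
      ENNReal.ofReal (couplingEnergy X.lapPinv Y.lapPinv P C) :=
  le_antisymm ((iInf₂_le P h.isPlan).trans (h.planCost_eq hx₀).le)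
    (le_iInf₂ fun _ hQ => le_planCost h hQ)

end FinGraph

/-! ### Gluing, symmetry and the triangle inequality -/

/-- Two finite families with the same Gram matrix differ by a linear isometry. -/
theorem exists_linearIsometry_of_inner_eq {ι H : Type*} [Fintype ι] [NormedAddCommGroup H]
    [InnerProductSpace ℝ H] [FiniteDimensional ℝ H] {v v' : ι → H}
    (h : ∀ i j, inner ℝ (v i) (v j) = inner ℝ (v' i) (v' j)) :
    ∃ R : H →ₗᵢ[ℝ] H, ∀ i, R (v i) = v' i := by
  classical
  set φ := Fintype.linearCombination ℝ v
  set φ' := Fintype.linearCombination ℝ v'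
  have hinner : ∀ c, ‖φ c‖ = ‖φ' c‖ := by
    intro c
    rw [← sq_eq_sq₀ (norm_nonneg _) (norm_nonneg _), ← real_inner_self_eq_norm_sq,
      ← real_inner_self_eq_norm_sq]
    simp only [φ, φ', Fintype.linearCombination_apply, sum_inner, inner_sum, real_inner_smul_left,
      real_inner_smul_right, h]
  have hker : LinearMap.ker φ ≤ LinearMap.ker φ' := by
    intro c hc
    rw [LinearMap.mem_ker] at hc ⊢
    rw [← norm_eq_zero, ← hinner, hc, norm_zero]
  let g : LinearMap.range φ →ₗ[ℝ] H :=
    ((LinearMap.ker φ).liftQ φ' hker).comp φ.quotKerEquivRange.symm.toLinearMap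
  have hg : ∀ c, g ⟨φ c, LinearMap.mem_range_self φ c⟩ = φ' c := by
    intro c
    have e : φ.quotKerEquivRange.symm ⟨φ c, LinearMap.mem_range_self φ c⟩ =
        Submodule.Quotient.mk c := by
      rw [LinearEquiv.symm_apply_eq]
      exact Subtype.ext (φ.quotKerEquivRange_apply_mk c).symm
    simp only [g, LinearMap.comp_apply, LinearEquiv.coe_coe, e]
    rfl
  let L : LinearMap.range φ →ₗᵢ[ℝ] H :=
    { toLinearMap := g
      norm_map' := by
        rintro ⟨_, c, rfl⟩
        rw [hg, ← hinner]
        rfl }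
  -- In finite dimension an isometry from a subspace into the whole space extends to the whole
  -- space.
  refine ⟨L.extend, fun i => ?_⟩
  have hi : φ (Pi.single i 1) = v i := by simp [φ]
  have hi' : φ' (Pi.single i 1) = v' i := by simp [φ']
  rw [← hi, ← hi', ← hg]
  exact L.extend_apply ⟨φ (Pi.single i 1), _⟩

/-- Cross-covariances `(A, D)` and `(D, B)` are realized by vectors in a common space. -/
theorem IsCrossCov.exists_glue {V W Z : Type*} [Fintype V] [Fintype W] [Fintype Z]
    {A : Matrix V V ℝ} {D : Matrix W W ℝ} {B : Matrix Z Z ℝ} {C₁ : Matrix V W ℝ}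
    {C₂ : Matrix W Z ℝ} (h₁ : IsCrossCov A D C₁) (h₂ : IsCrossCov D B C₂) :
    ∃ (u : V → WithLp 2 (EuclideanSpace ℝ (V ⊕ W) × EuclideanSpace ℝ (W ⊕ Z)))
      (v : W → WithLp 2 (EuclideanSpace ℝ (V ⊕ W) × EuclideanSpace ℝ (W ⊕ Z)))
      (w : Z → WithLp 2 (EuclideanSpace ℝ (V ⊕ W) × EuclideanSpace ℝ (W ⊕ Z))),
      (∀ x x', inner ℝ (u x) (u x') = A x x') ∧ (∀ y y', inner ℝ (v y) (v y') = D y y') ∧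
      (∀ z z', inner ℝ (w z) (w z') = B z z') ∧ (∀ x y, inner ℝ (u x) (v y) = C₁ x y) ∧
      ∀ y z, inner ℝ (v y) (w z) = C₂ y z := by
  obtain ⟨u, v, hu, hv, huv⟩ := h₁.exists_inner_eq
  obtain ⟨v', w, hv', hw, hvw⟩ := h₂.exists_inner_eq
  obtain ⟨R, hR⟩ := exists_linearIsometry_of_inner_eq
    (H := WithLp 2 (EuclideanSpace ℝ (V ⊕ W) × EuclideanSpace ℝ (W ⊕ Z)))
    (v := fun y => WithLp.toLp 2 (v y, 0)) (v' := fun y => WithLp.toLp 2 (0, v' y))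
    (fun i j => by simp [WithLp.prod_inner_apply, hv, hv'])
  refine ⟨fun x => R (WithLp.toLp 2 (u x, 0)), fun y => WithLp.toLp 2 (0, v' y),
    fun z => WithLp.toLp 2 (0, w z), ?_, ?_, ?_, ?_, ?_⟩
  · intro x x'; simp [WithLp.prod_inner_apply, hu]
  · intro y y'; simp [WithLp.prod_inner_apply, hv']
  · intro z z'; simp [WithLp.prod_inner_apply, hw]
  · intro x y
    change inner ℝ (R (WithLp.toLp 2 (u x, 0))) (WithLp.toLp 2 (0, v' y)) = C₁ x y
    rw [← hR y, R.inner_map_map]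
    simp [WithLp.prod_inner_apply, huv]
  · intro y z; simp [WithLp.prod_inner_apply, hvw]

/-- Minkowski's inequality for weighted square sums of distances. -/
theorem sqrt_sum_mul_norm_sub_sq_le {ι H : Type*} [Fintype ι] [NormedAddCommGroup H]
    (ω : ι → ℝ) (hω : ∀ i, 0 ≤ ω i) (a b c : ι → H) :
    √(∑ i, ω i * ‖a i - c i‖ ^ 2) ≤
      √(∑ i, ω i * ‖a i - b i‖ ^ 2) + √(∑ i, ω i * ‖b i - c i‖ ^ 2) := by
  let p : EuclideanSpace ℝ ι := WithLp.toLp 2 fun i => √(ω i) * ‖a i - b i‖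
  let q : EuclideanSpace ℝ ι := WithLp.toLp 2 fun i => √(ω i) * ‖b i - c i‖
  have h := norm_add_le p q
  simp only [EuclideanSpace.norm_eq, p, q, PiLp.add_apply, Real.norm_eq_abs, sq_abs, mul_pow,
    Real.sq_sqrt (hω _)] at h
  refine le_trans (Real.sqrt_le_sqrt (Finset.sum_le_sum fun i _ => ?_)) h
  rw [← mul_add, mul_pow, Real.sq_sqrt (hω i)]
  gcongr
  · exact hω i
  · exact norm_sub_le_norm_sub_add_norm_sub _ _ _

theorem IsCrossCov.couplingEnergy_nonneg {V W : Type*} [Fintype V] [Fintype W]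
    {A : Matrix V V ℝ} {D : Matrix W W ℝ} {C P : V → W → ℝ}
    (h : IsCrossCov A D (Matrix.of C)) (hP : ∀ x y, 0 ≤ P x y) : 0 ≤ couplingEnergy A D P C := by
  obtain ⟨u, v, hu, hv, huv⟩ := h.exists_inner_eq
  rw [couplingEnergy_eq_of_inner (C := C) hu hv huv]
  exact Finset.sum_nonneg fun x _ => Finset.sum_nonneg fun y _ => mul_nonneg (sq_nonneg _) (hP x y)

namespace FinGraph

variable {X Y Z : FinGraph.{u}}

theorem IsMinimal.couplingEnergy_eq {P C P' C' : X.V → Y.V → ℝ} (h : IsMinimal X Y P C)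
    (h' : IsMinimal X Y P' C') :
    couplingEnergy X.lapPinv Y.lapPinv P C = couplingEnergy X.lapPinv Y.lapPinv P' C' :=
  le_antisymm (h.le _ _ h'.isPlan h'.isCrossCov) (h'.le _ _ h.isPlan h.isCrossCov)

theorem IsMinimal.symm {P C : X.V → Y.V → ℝ} (h : IsMinimal X Y P C) :
    IsMinimal Y X (fun y x => P x y) (fun y x => C x y) where
  isPlan := h.isPlan.symm
  isCrossCov := IsCrossCov.symm h.isCrossCov
  le Q C' hQ hC' := by
    have := h.le (fun x y => Q y x) (fun x y => C' y x) hQ.symm (IsCrossCov.symm hC')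
    rw [couplingEnergy_transpose Y.lapPinv X.lapPinv Q C'] at this
    rwa [couplingEnergy_transpose X.lapPinv Y.lapPinv P C]

/-- The minimal transport energy over all plans and cross-covariances. -/
def minEnergy (X Y : FinGraph.{u}) : ℝ :=
  couplingEnergy X.lapPinv Y.lapPinv (exists_isMinimal X Y).choose
    (exists_isMinimal X Y).choose_spec.choose

theorem IsMinimal.couplingEnergy_eq_minEnergy {P C : X.V → Y.V → ℝ} (h : IsMinimal X Y P C) :
    couplingEnergy X.lapPinv Y.lapPinv P C = minEnergy X Y :=
  h.couplingEnergy_eq (exists_isMinimal X Y).choose_spec.choose_spec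

theorem minEnergy_nonneg (X Y : FinGraph.{u}) : 0 ≤ minEnergy X Y := by
  obtain ⟨P, C, h⟩ := exists_isMinimal X Y
  rw [← h.couplingEnergy_eq_minEnergy]
  exact IsCrossCov.couplingEnergy_nonneg h.isCrossCov h.isPlan.nonneg

theorem minEnergy_comm (X Y : FinGraph.{u}) : minEnergy X Y = minEnergy Y X := by
  obtain ⟨P, C, h⟩ := exists_isMinimal X Y
  rw [← h.couplingEnergy_eq_minEnergy, ← h.symm.couplingEnergy_eq_minEnergy,
    couplingEnergy_transpose]

/-- The real-valued version of the distance `copt`. -/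
def optDist (X Y : FinGraph.{u}) : ℝ :=
  √(minEnergy X Y / (Fintype.card X.V * Fintype.card Y.V))

theorem optDist_comm (X Y : FinGraph.{u}) : optDist X Y = optDist Y X := by
  rw [optDist, optDist, minEnergy_comm, mul_comm]

theorem optDist_eq_zero_iff [Nonempty X.V] [Nonempty Y.V] :
    optDist X Y = 0 ↔ minEnergy X Y = 0 := by
  have hN : (Fintype.card X.V : ℝ) ≠ 0 := by exact_mod_cast Fintype.card_ne_zero
  have hM : (Fintype.card Y.V : ℝ) ≠ 0 := by exact_mod_cast Fintype.card_ne_zero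
  rw [optDist, Real.sqrt_eq_zero (div_nonneg (minEnergy_nonneg X Y) (by positivity))]
  simp [hN, hM]

theorem copt_eq_ofReal_optDist {x₀ : X.V} (hx₀ : X.lapPinv x₀ x₀ ≠ 0) [Nonempty Y.V] :
    copt X Y = ENNReal.ofReal (optDist X Y) := by
  have : Nonempty X.V := ⟨x₀⟩
  obtain ⟨P, C, h⟩ := exists_isMinimal X Y
  have hN : (0 : ℝ) < Fintype.card X.V := by exact_mod_cast Fintype.card_pos
  have hM : (0 : ℝ) < Fintype.card Y.V := by exact_mod_cast Fintype.card_pos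
  rw [copt, h.iInf_planCost_eq hx₀, h.couplingEnergy_eq_minEnergy, optDist, Real.sqrt_eq_rpow,
    ← ENNReal.ofReal_rpow_of_nonneg (div_nonneg (minEnergy_nonneg X Y) (by positivity))
      (by norm_num),
    ENNReal.ofReal_div_of_pos (by positivity), ENNReal.ofReal_mul hN.le,
    ENNReal.ofReal_natCast, ENNReal.ofReal_natCast]

/-- After normalization this is the composition of Markov kernels; dividing by `|Y|` restores the
marginals. -/
theorem IsPlan.comp [Nonempty Y.V] {P : X.V → Y.V → ℝ} {Q : Y.V → Z.V → ℝ} (hP : IsPlan X Y P)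
    (hQ : IsPlan Y Z Q) :
    IsPlan X Z fun x z => ∑ y, P x y * Q y z / Fintype.card Y.V where
  nonneg x z := Finset.sum_nonneg fun y _ =>
    div_nonneg (mul_nonneg (hP.nonneg x y) (hQ.nonneg y z)) (Nat.cast_nonneg _)
  sum_left z := by
    have hM : (Fintype.card Y.V : ℝ) ≠ 0 := by exact_mod_cast Fintype.card_ne_zero
    rw [Finset.sum_comm]
    simp only [← Finset.sum_div, ← Finset.sum_mul, ← Finset.mul_sum, hP.sum_left, hQ.sum_left]
    field_simp
  sum_right x := by
    have hM : (Fintype.card Y.V : ℝ) ≠ 0 := by exact_mod_cast Fintype.card_ne_zero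
    rw [Finset.sum_comm]
    simp only [← Finset.sum_div, ← Finset.sum_mul, ← Finset.mul_sum, hP.sum_right, hQ.sum_right]
    field_simp

theorem optDist_triangle (X Y Z : FinGraph.{u}) [Nonempty X.V] [Nonempty Y.V] [Nonempty Z.V] :
    optDist X Z ≤ optDist X Y + optDist Y Z := by
  obtain ⟨P, C₁, h₁⟩ := exists_isMinimal X Y
  obtain ⟨Q, C₂, h₂⟩ := exists_isMinimal Y Z
  obtain ⟨R, C₃, h₃⟩ := exists_isMinimal X Z
  obtain ⟨u, v, w, hu, hv, hw, huv, hvw⟩ := IsCrossCov.exists_glue h₁.isCrossCov h₂.isCrossCov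
  have hN : (Fintype.card X.V : ℝ) ≠ 0 := by exact_mod_cast Fintype.card_ne_zero
  have hM : (Fintype.card Y.V : ℝ) ≠ 0 := by exact_mod_cast Fintype.card_ne_zero
  have hK : (Fintype.card Z.V : ℝ) ≠ 0 := by exact_mod_cast Fintype.card_ne_zero
  have hle := h₃.le _ (fun x z => inner ℝ (u x) (w z)) (h₁.isPlan.comp h₂.isPlan)
    (isCrossCov_of_inner u w hu hw fun _ _ => rfl)
  rw [h₃.couplingEnergy_eq_minEnergy, couplingEnergy_eq_of_inner hu hw fun _ _ => rfl] at hle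
  have e₁ := couplingEnergy_eq_of_inner (C := C₁) hu hv huv P
  have e₂ := couplingEnergy_eq_of_inner (C := C₂) hv hw hvw Q
  rw [h₁.couplingEnergy_eq_minEnergy] at e₁
  rw [h₂.couplingEnergy_eq_minEnergy] at e₂
  set N : ℝ := (Fintype.card X.V : ℝ)
  set M : ℝ := (Fintype.card Y.V : ℝ)
  set K : ℝ := (Fintype.card Z.V : ℝ)
  -- The weights form the glued probability on triples: summing out `z`, `x` or `y` leaves the
  -- normalized `P`, `Q` or composed plan.
  have hmink := sqrt_sum_mul_norm_sub_sq_le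
    (fun i : X.V × Y.V × Z.V => P i.1 i.2.1 * Q i.2.1 i.2.2 / (N * M * K))
    (fun i => div_nonneg (mul_nonneg (h₁.isPlan.nonneg _ _) (h₂.isPlan.nonneg _ _))
      (by positivity))
    (fun i => u i.1) (fun i => v i.2.1) (fun i => w i.2.2)
  simp only [Fintype.sum_prod_type] at hmink
  have s₁ : ∑ x, ∑ y, ∑ z, P x y * Q y z / (N * M * K) * ‖u x - v y‖ ^ 2 =
      minEnergy X Y / (N * M) := by
    rw [e₁]
    simp only [Finset.sum_div]
    refine Finset.sum_congr rfl fun x _ => Finset.sum_congr rfl fun y _ => ?_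
    rw [← Finset.sum_mul, ← Finset.sum_div, ← Finset.mul_sum, h₂.isPlan.sum_right]
    change P x y * K / (N * M * K) * _ = _
    field_simp
  have s₂ : ∑ x, ∑ y, ∑ z, P x y * Q y z / (N * M * K) * ‖v y - w z‖ ^ 2 =
      minEnergy Y Z / (M * K) := by
    rw [e₂, Finset.sum_comm]
    simp only [Finset.sum_div]
    refine Finset.sum_congr rfl fun y _ => ?_
    rw [Finset.sum_comm]
    refine Finset.sum_congr rfl fun z _ => ?_
    rw [← Finset.sum_mul, ← Finset.sum_div, ← Finset.sum_mul, h₁.isPlan.sum_left]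
    change N * Q y z / (N * M * K) * _ = _
    field_simp
  have s₃ : ∑ x, ∑ y, ∑ z, P x y * Q y z / (N * M * K) * ‖u x - w z‖ ^ 2 =
      (∑ x, ∑ z, ‖u x - w z‖ ^ 2 * ∑ y, P x y * Q y z / M) / (N * K) := by
    simp only [Finset.sum_div]
    refine Finset.sum_congr rfl fun x _ => ?_
    rw [Finset.sum_comm]
    refine Finset.sum_congr rfl fun z _ => ?_
    rw [Finset.mul_sum, Finset.sum_div]
    refine Finset.sum_congr rfl fun y _ => ?_
    field_simp
  rw [s₁, s₂, s₃] at hmink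
  refine le_trans (Real.sqrt_le_sqrt ?_) hmink
  gcongr

end FinGraph

/-! ### Recovering a graph from the pseudo-inverse of its Laplacian -/

section PenroseInverse

variable {V W : Type u} [Fintype V] [DecidableEq V] [Fintype W] [DecidableEq W]

/-- The Penrose equations determine the pseudo-inverse. -/
theorem symmPinv_eq_of_penrose {A B : Matrix V V ℝ} (hA : A.IsHermitian) (h₁ : A * B * A = A)
    (h₂ : B * A * B = B) (h₃ : (A * B).IsHermitian) (h₄ : (B * A).IsHermitian) :
    symmPinv A = B := by
  obtain ⟨g₁, g₂, g₃, g₄⟩ := symmPinv_penrose hA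
  set B' := symmPinv A
  have e₁ : A * B' = A * B := by
    have h : A * B * (A * B') = A * B' := by rw [← mul_assoc, h₁]
    -- Both factors are self-adjoint, so the adjoint reverses their product, which then collapses to
    -- `A * B`.
    have h' := congrArg Matrix.conjTranspose h
    rw [Matrix.conjTranspose_mul, h₃.eq, g₃.eq, ← mul_assoc, g₁] at h'
    exact h'.symm
  have e₂ : B' * A = B * A := by
    have h : B' * A * (B * A) = B' * A := by rw [mul_assoc, ← mul_assoc A, h₁]
    have h' := congrArg Matrix.conjTranspose h
    rw [Matrix.conjTranspose_mul, h₄.eq, g₄.eq, mul_assoc, ← mul_assoc A, g₁] at h'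
    exact h'.symm
  rw [← g₂, e₂, mul_assoc, e₁, ← mul_assoc, h₂]

theorem symmPinv_symmPinv {A : Matrix V V ℝ} (hA : A.IsHermitian) :
    symmPinv (symmPinv A) = A := by
  obtain ⟨g₁, g₂, g₃, g₄⟩ := symmPinv_penrose hA
  exact symmPinv_eq_of_penrose (symmPinv_isHermitian A) g₂ g₁ g₄ g₃

theorem symmPinv_submatrix_equiv {A : Matrix V V ℝ} (hA : A.IsHermitian) (e : W ≃ V) :
    symmPinv (A.submatrix e e) = (symmPinv A).submatrix e e := by
  obtain ⟨g₁, g₂, g₃, g₄⟩ := symmPinv_penrose hA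
  apply symmPinv_eq_of_penrose (hA.submatrix e)
  · simp only [Matrix.submatrix_mul_equiv, g₁]
  · simp only [Matrix.submatrix_mul_equiv, g₂]
  · rw [Matrix.submatrix_mul_equiv]; exact g₃.submatrix e
  · rw [Matrix.submatrix_mul_equiv]; exact g₄.submatrix e

/-- `A` commutes with its pseudo-inverse, so `A = A * A * symmPinv A`. -/
theorem mulVec_eq_zero_of_symmPinv_mulVec_eq_zero {A : Matrix V V ℝ} (hA : A.IsHermitian)
    {a : V → ℝ} (h : (symmPinv A).mulVec a = 0) : A.mulVec a = 0 := by
  obtain ⟨g₁, g₂, g₃, g₄⟩ := symmPinv_penrose hA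
  have e : A * symmPinv A = symmPinv A * A := by
    rw [← g₃.eq, Matrix.conjTranspose_mul, hA.eq, (symmPinv_isHermitian A).eq]
  rw [← g₁, mul_assoc, ← e, ← Matrix.mulVec_mulVec, ← Matrix.mulVec_mulVec, h]
  simp

theorem symmPinv_mulVec_eq_zero_iff {A : Matrix V V ℝ} (hA : A.IsHermitian) {a : V → ℝ} :
    (symmPinv A).mulVec a = 0 ↔ A.mulVec a = 0 :=
  ⟨mulVec_eq_zero_of_symmPinv_mulVec_eq_zero hA, fun h =>
    mulVec_eq_zero_of_symmPinv_mulVec_eq_zero (symmPinv_isHermitian A)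
      (by rwa [symmPinv_symmPinv hA])⟩

end PenroseInverse

namespace FinGraph

variable {X Y : FinGraph.{u}}

open Classical in
/-- The Laplacian of a finite graph. -/
def lap (X : FinGraph.{u}) : Matrix X.V X.V ℝ := X.graph.lapMatrix ℝ

theorem lap_isHermitian (X : FinGraph.{u}) : X.lap.IsHermitian := by
  classical exact X.graph.isHermitian_lapMatrix ℝ

open Classical in
theorem lapPinv_eq (X : FinGraph.{u}) : X.lapPinv = symmPinv X.lap := rfl

open Classical in
theorem lap_eq (X : FinGraph.{u}) : X.lap = X.graph.lapMatrix ℝ := rfl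

open Classical in
theorem lap_apply (X : FinGraph.{u}) (x x' : X.V) :
    X.lap x x' = (if x = x' then ∑ z, if X.graph.Adj x z then (1 : ℝ) else 0 else 0) -
      if X.graph.Adj x x' then 1 else 0 := by
  rw [lap_eq, SimpleGraph.lapMatrix, SimpleGraph.degMatrix, Matrix.sub_apply,
    Matrix.diagonal_apply, SimpleGraph.adjMatrix_apply, ← SimpleGraph.degree_eq_sum_if_adj]

theorem adj_iff_lap (X : FinGraph.{u}) (x x' : X.V) :
    X.graph.Adj x x' ↔ x ≠ x' ∧ X.lap x x' ≠ 0 := by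
  classical
  by_cases h : x = x'
  · subst h; simp
  · simp [lap_apply, h]

theorem lapPinv_mulVec_eq_zero_iff (X : FinGraph.{u}) {a : X.V → ℝ} :
    X.lapPinv.mulVec a = 0 ↔ ∀ i j, X.graph.Adj i j → a i = a j := by
  classical
  rw [lapPinv_eq, symmPinv_mulVec_eq_zero_iff X.lap_isHermitian, lap_eq,
    SimpleGraph.lapMatrix_mulVec_eq_zero_iff_forall_adj]

open Classical in
theorem lapPinv_mulVec_single (X : FinGraph.{u}) (x : X.V) :
    X.lapPinv.mulVec (Pi.single x 1) = fun z => X.lapPinv z x := by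
  ext z; simp

theorem lapPinv_eq_submatrix (e : X.graph ≃g Y.graph) :
    X.lapPinv = Y.lapPinv.submatrix e e := by
  classical
  have h : X.lap = Y.lap.submatrix e.toEquiv e.toEquiv := by
    ext x x'
    have hs : ∑ z, (if X.graph.Adj x z then (1 : ℝ) else 0) =
        ∑ z, if Y.graph.Adj (e x) z then (1 : ℝ) else 0 := by
      rw [← e.toEquiv.sum_comp]
      refine Finset.sum_congr rfl fun z _ => ?_
      exact if_congr (e.map_adj_iff (v := x) (w := z)).symm rfl rfl
    rw [Matrix.submatrix_apply, lap_apply, lap_apply, hs]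
    simp only [RelIso.coe_fn_toEquiv, e.map_adj_iff, EmbeddingLike.apply_eq_iff_eq]
  rw [lapPinv_eq, h, symmPinv_submatrix_equiv Y.lap_isHermitian, lapPinv_eq]
  rfl

/-- The Laplacian is the pseudo-inverse of its pseudo-inverse, and its off-diagonal entries record
adjacency. -/
theorem nonempty_iso_of_lapPinv_eq_submatrix (e : X.V ≃ Y.V)
    (h : X.lapPinv = Y.lapPinv.submatrix e e) : Nonempty (X.graph ≃g Y.graph) := by
  classical
  have hlap : X.lap = Y.lap.submatrix e e := by
    rw [← symmPinv_symmPinv X.lap_isHermitian, ← lapPinv_eq, h, lapPinv_eq,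
      symmPinv_submatrix_equiv (symmPinv_isHermitian _), symmPinv_symmPinv Y.lap_isHermitian]
  exact ⟨⟨e, fun {x x'} => by
    rw [adj_iff_lap, adj_iff_lap, hlap, Matrix.submatrix_apply, e.injective.ne_iff]⟩⟩

/-- Use the same vectors for both graphs and the plan concentrated on the graph of `e`. -/
theorem optDist_eq_zero_of_iso [Nonempty X.V] [Nonempty Y.V] (e : X.graph ≃g Y.graph) :
    optDist X Y = 0 := by
  classical
  rw [optDist_eq_zero_iff]
  obtain ⟨v, hv⟩ := Y.lapPinv_posSemidef.exists_inner_eq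
  have hu : ∀ x x', inner ℝ (v (e x)) (v (e x')) = X.lapPinv x x' := fun x x' => by
    rw [hv, lapPinv_eq_submatrix e, Matrix.submatrix_apply]
  have hcard : Fintype.card X.V = Fintype.card Y.V := Fintype.card_congr e.toEquiv
  obtain ⟨P, C, h⟩ := exists_isMinimal X Y
  refine le_antisymm ?_ (minEnergy_nonneg X Y)
  have hle := h.le (fun x y => if e x = y then (Fintype.card X.V : ℝ) else 0)
    (fun x y => inner ℝ (v (e x)) (v y)) ⟨fun x y => ?_, fun y => ?_, fun x => ?_⟩
    (isCrossCov_of_inner (fun x => v (e x)) v hu hv fun _ _ => rfl)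
  · rw [h.couplingEnergy_eq_minEnergy,
      couplingEnergy_eq_of_inner (u := fun x => v (e x)) hu hv fun _ _ => rfl] at hle
    refine hle.trans (le_of_eq ?_)
    refine Finset.sum_eq_zero fun x _ => Finset.sum_eq_zero fun y _ => ?_
    split_ifs with hxy
    · simp [hxy]
    · simp
  · split_ifs <;> positivity
  · rw [Finset.sum_eq_single (e.symm y)]
    · simp
    · intro x _ hx
      rw [if_neg]
      rintro rfl
      simp at hx
    · simp
  · simp [hcard]

end FinGraph

/-! ### Distance zero implies isomorphism -/

/-- A plan supported on pairs of equal vectors yields a bijection preserving the vectors, if the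
nonzero vectors of both families are distinct. -/
theorem exists_equiv_of_plan {V W H : Type*} [Fintype V] [Fintype W] [Nonempty W] [Zero H]
    {u : V → H} {v : W → H} (hu : ∀ x x', u x = u x' → u x ≠ 0 → x = x')
    (hv : ∀ y y', v y = v y' → v y ≠ 0 → y = y') {x₀ : V} (hx₀ : u x₀ ≠ 0) {P : V → W → ℝ}
    (h₁ : ∀ y, ∑ x, P x y = Fintype.card V) (h₂ : ∀ x, ∑ y, P x y = Fintype.card W)
    (h : ∀ x y, P x y ≠ 0 → u x = v y) : ∃ e : V ≃ W, ∀ x, u x = v (e x) := by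
  classical
  have : Nonempty V := ⟨x₀⟩
  have hN : (Fintype.card V : ℝ) ≠ 0 := by exact_mod_cast Fintype.card_ne_zero
  have hM : (Fintype.card W : ℝ) ≠ 0 := by exact_mod_cast Fintype.card_ne_zero
  have hP₁ : ∀ y, ∃ x, P x y ≠ 0 := fun y => by
    obtain ⟨x, -, hx⟩ := Finset.exists_ne_zero_of_sum_ne_zero (h₁ y ▸ hN)
    exact ⟨x, hx⟩
  have hP₂ : ∀ x, ∃ y, P x y ≠ 0 := fun x => by
    obtain ⟨y, -, hy⟩ := Finset.exists_ne_zero_of_sum_ne_zero (h₂ x ▸ hM)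
    exact ⟨y, hy⟩
  -- A nonzero vector occurs once in each family, so `P x₀ y₀` is the only nonzero entry in its row
  -- and its column; it equals both cardinalities.
  have hcard : Fintype.card V = Fintype.card W := by
    obtain ⟨y₀, hy₀⟩ := hP₂ x₀
    have huv := h x₀ y₀ hy₀
    have e₁ : ∑ x, P x y₀ = P x₀ y₀ := Finset.sum_eq_single x₀
      (fun x _ hx => by_contra fun hne =>
        hx (hu x₀ x (huv.trans (h x y₀ hne).symm) hx₀).symm) (by simp)
    have e₂ : ∑ y, P x₀ y = P x₀ y₀ := Finset.sum_eq_single y₀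
      (fun y _ hy => by_contra fun hne =>
        hy (hv y₀ y (huv.symm.trans (h x₀ y hne)) (huv ▸ hx₀)).symm) (by simp)
    have e₃ := (h₁ y₀).symm.trans (e₁.trans (e₂.symm.trans (h₂ x₀)))
    exact_mod_cast e₃
  choose f hf using hP₂
  have huf : ∀ x, u x = v (f x) := fun x => h x _ (hf x)
  let F : {x // u x ≠ 0} → {y // v y ≠ 0} := fun x => ⟨f x, huf x ▸ x.2⟩
  have hF : Function.Bijective F := by
    constructor
    · intro x x' hxx
      have e : f x = f x' := congrArg Subtype.val hxx
      exact Subtype.ext (hu _ _ (by rw [huf, huf, e]) x.2)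
    · intro y
      obtain ⟨x, hx⟩ := hP₁ y
      have huy := h x y hx
      refine ⟨⟨x, huy ▸ y.2⟩, Subtype.ext ?_⟩
      exact hv _ _ ((huf x).symm.trans huy) (huf x ▸ huy ▸ y.2)
  let e₁ := Equiv.ofBijective F hF
  -- The remaining vectors all vanish, so any bijection between their indices will do.
  let e₂ : {x // ¬ u x ≠ 0} ≃ {y // ¬ v y ≠ 0} := Fintype.equivOfCardEq (by
    rw [Fintype.card_subtype_compl fun x => u x ≠ 0, Fintype.card_subtype_compl fun y => v y ≠ 0,
      hcard, Fintype.card_congr e₁])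
  refine ⟨(Equiv.sumCompl _).symm.trans ((Equiv.sumCongr e₁ e₂).trans (Equiv.sumCompl _)),
    fun x => ?_⟩
  obtain ⟨z, rfl⟩ := (Equiv.sumCompl fun x => u x ≠ 0).surjective x
  rw [Equiv.trans_apply, Equiv.symm_apply_apply]
  rcases z with z | z
  · exact huf z
  · exact (not_not.1 z.2).trans (not_not.1 (e₂ z).2).symm

namespace FinGraph

variable {X Y : FinGraph.{u}}

/-- In a Gram realization of `L_X†`, the vectors of non-isolated vertices are nonzero. -/
theorem ne_zero_of_adj {H : Type*} [NormedAddCommGroup H] [InnerProductSpace ℝ H] {u : X.V → H}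
    (hu : ∀ x x', inner ℝ (u x) (u x') = X.lapPinv x x') {a b : X.V} (hab : X.graph.Adj a b) :
    u a ≠ 0 := by
  classical
  intro h
  have h0 : X.lapPinv.mulVec (Pi.single a 1) = 0 := by
    rw [lapPinv_mulVec_single]
    funext z
    rw [← hu, h, inner_zero_right, Pi.zero_apply]
  have := (X.lapPinv_mulVec_eq_zero_iff).1 h0 a b hab
  simp [hab.ne'] at this

/-- In a Gram realization of `L_X†`, distinct vertices with nonzero vectors have distinct
vectors. -/
theorem eq_of_vector_eq {H : Type*} [NormedAddCommGroup H] [InnerProductSpace ℝ H] {u : X.V → H}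
    (hu : ∀ x x', inner ℝ (u x) (u x') = X.lapPinv x x') {x x' : X.V} (h : u x = u x')
    (hx : u x ≠ 0) : x = x' := by
  classical
  by_contra hne
  have hadj : ∃ z, X.graph.Adj x z := by
    by_contra hno
    push Not at hno
    have h0 : X.lapPinv.mulVec (Pi.single x 1) = 0 := by
      rw [lapPinv_mulVec_eq_zero_iff]
      intro i j hij
      rw [Pi.single_eq_of_ne, Pi.single_eq_of_ne]
      · rintro rfl; exact hno _ hij.symm
      · rintro rfl; exact hno _ hij
    rw [lapPinv_mulVec_single] at h0
    have h1 := congrFun h0 x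
    rw [← hu, Pi.zero_apply, inner_self_eq_zero] at h1
    exact hx h1
  obtain ⟨z, hz⟩ := hadj
  have h0 : X.lapPinv.mulVec (Pi.single x 1 - Pi.single x' 1) = 0 := by
    rw [Matrix.mulVec_sub, lapPinv_mulVec_single, lapPinv_mulVec_single]
    funext w
    simp [← hu, h]
  have := (X.lapPinv_mulVec_eq_zero_iff).1 h0 x z hz
  rw [Pi.sub_apply, Pi.sub_apply, Pi.single_eq_same, Pi.single_eq_of_ne hne,
    Pi.single_eq_of_ne hz.ne', Pi.single_apply] at this
  -- The function is `1` at `x`, but `-1` or `0` at its neighbour `z`, according to whether `z =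
  -- x'`.
  split_ifs at this <;> norm_num at this

theorem nonempty_iso_of_optDist_eq_zero [Nonempty Y.V] {a b : X.V} (hab : X.graph.Adj a b)
    (h0 : optDist X Y = 0) : Nonempty (X.graph ≃g Y.graph) := by
  have : Nonempty X.V := ⟨a⟩
  rw [optDist_eq_zero_iff] at h0
  obtain ⟨P, C, h⟩ := exists_isMinimal X Y
  obtain ⟨u, v, hu, hv, huv⟩ := IsCrossCov.exists_inner_eq h.isCrossCov
  rw [← h.couplingEnergy_eq_minEnergy, couplingEnergy_eq_of_inner (C := C) hu hv huv] at h0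
  have hterm : ∀ x y, 0 ≤ ‖u x - v y‖ ^ 2 * P x y := fun x y =>
    mul_nonneg (sq_nonneg _) (h.isPlan.nonneg x y)
  have hsupp : ∀ x y, P x y ≠ 0 → u x = v y := by
    intro x y hP
    have h1 := (Finset.sum_eq_zero_iff_of_nonneg
      (fun x _ => Finset.sum_nonneg fun y _ => hterm x y)).1 h0 x (Finset.mem_univ x)
    have h2 := (Finset.sum_eq_zero_iff_of_nonneg (fun y _ => hterm x y)).1 h1 y (Finset.mem_univ y)
    have h3 := (mul_eq_zero.1 h2).resolve_right hP
    exact sub_eq_zero.1 (norm_eq_zero.1 (pow_eq_zero_iff two_ne_zero |>.1 h3))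
  obtain ⟨e, he⟩ := exists_equiv_of_plan (fun x x' => eq_of_vector_eq hu)
    (fun y y' => eq_of_vector_eq hv) (ne_zero_of_adj hu hab) h.isPlan.sum_left h.isPlan.sum_right
    hsupp
  refine nonempty_iso_of_lapPinv_eq_submatrix e ?_
  ext x x'
  rw [Matrix.submatrix_apply, ← hu, ← hv, he, he]

theorem lapPinv_diag_ne_zero_of_adj {a b : X.V} (hab : X.graph.Adj a b) : X.lapPinv a a ≠ 0 := by
  obtain ⟨u, hu⟩ := X.lapPinv_posSemidef.exists_inner_eq
  rw [← hu, Ne, inner_self_eq_zero]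
  exact ne_zero_of_adj hu hab

end FinGraph

/-! ### The metric on isomorphism classes -/

instance (X : FinGraphWithEdge.{u}) : Nonempty X.1.V := X.2.nonempty

/-- The metric on isomorphism classes of graphs with at least one edge. -/
abbrev graphMetricSpace : MetricSpace GraphIsoClass.{u} where
  dist := Quotient.lift₂ (fun X Y => FinGraph.optDist X.1 Y.1) fun X Y X' Y' ⟨e⟩ ⟨e'⟩ => by
    have h₁ := FinGraph.optDist_eq_zero_of_iso e
    have h₂ := FinGraph.optDist_eq_zero_of_iso e'
    have h₁' := FinGraph.optDist_comm X'.1 X.1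
    have h₂' := FinGraph.optDist_comm Y'.1 Y.1
    -- Isomorphic graphs are at distance zero, so the triangle inequality makes the distance
    -- independent of representatives.
    apply le_antisymm
    · linarith [FinGraph.optDist_triangle X.1 X'.1 Y.1, FinGraph.optDist_triangle X'.1 Y'.1 Y.1]
    · linarith [FinGraph.optDist_triangle X'.1 X.1 Y'.1, FinGraph.optDist_triangle X.1 Y.1 Y'.1]
  dist_self := by
    rintro ⟨X⟩
    exact FinGraph.optDist_eq_zero_of_iso SimpleGraph.Iso.refl
  dist_comm := by
    rintro ⟨X⟩ ⟨Y⟩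
    exact FinGraph.optDist_comm X.1 Y.1
  dist_triangle := by
    rintro ⟨X⟩ ⟨Y⟩ ⟨Z⟩
    exact FinGraph.optDist_triangle X.1 Y.1 Z.1
  eq_of_dist_eq_zero := by
    rintro ⟨X⟩ ⟨Y⟩ h
    obtain ⟨a, b, hab⟩ := X.2
    exact Quotient.sound (FinGraph.nonempty_iso_of_optDist_eq_zero hab h)

end

theorem lemma3p2 :
    -- the minimum over transport plans in the definition of `Δ` is attained
    (∀ X Y : FinGraphWithEdge.{u}, ∃ P : X.1.V → Y.1.V → ℝ, FinGraph.IsPlan X.1 Y.1 P ∧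
      ∀ Q : X.1.V → Y.1.V → ℝ, FinGraph.IsPlan X.1 Y.1 Q →
        FinGraph.planCost X.1 Y.1 P ≤ FinGraph.planCost X.1 Y.1 Q) ∧
    -- `Δ` is (finite and) a metric on isomorphism classes
    ∃ _ : MetricSpace GraphIsoClass.{u}, ∀ X Y : FinGraphWithEdge.{u},
      ENNReal.ofReal (dist (Quotient.mk isoSetoid X) (Quotient.mk isoSetoid Y)) =
        FinGraph.copt X.1 Y.1 := by
  refine ⟨fun X Y => ?_, graphMetricSpace, fun X Y => ?_⟩
  · obtain ⟨a, b, hab⟩ := X.2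
    obtain ⟨P, C, h⟩ := FinGraph.exists_isMinimal X.1 Y.1
    refine ⟨P, h.isPlan, fun Q hQ => ?_⟩
    rw [h.planCost_eq (FinGraph.lapPinv_diag_ne_zero_of_adj hab)]
    exact FinGraph.le_planCost h hQ
  · obtain ⟨a, b, hab⟩ := X.2
    exact (FinGraph.copt_eq_ofReal_optDist (FinGraph.lapPinv_diag_ne_zero_of_adj hab)).symm
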